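/- There is a sequence $(\mathcal F_k)_{k\ge 1}$ of tilings of the Euclidean plane by convex polygons with the following properties. Every $\mathcal F_k$ is normal (for some $r,R>0$ every tile contains a disk of radius $r$ and is contained in a disk of radius $R$) and each of its tiles has at least six edges. One tile of $\mathcal F_k$ is a regular $6k$-gon centred at the origin, and every other tile is a hexagon of unit area. Consequently all but finitely many tiles have index $0$, where the index of a polygon is the number of its edges minus $6$, and the total index, that is, the sum of the indices of all tiles, is $i(\mathcal F_k)=6k-6$. The maximal diameter $D_k$ and the minimal area $A_k$ of the tiles of $\mathcal F_k$ exist (both are attained), and \[ \lim_{k\to\infty}\frac{\frac{2\pi D_k^2}{A_k}-6}{i(\mathcal F_k)}=\frac43 . \] -/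

import Mathlib

open Filter Topology MeasureTheory

/-- The Euclidean plane. -/
abbrev Plane : Type := EuclideanSpace ℝ (Fin 2)

/-- Twice the signed area of the triangle `a b c`; it is positive exactly if `a, b, c` is a
nondegenerate triangle listed counterclockwise. -/
def orient (a b c : Plane) : ℝ :=
  (b 0 - a 0) * (c 1 - a 1) - (b 1 - a 1) * (c 0 - a 0)

/-- A convex polygon, given by its vertices `v₀, …, vₙ₋₁` (`n ≥ 3`) in counterclockwise order;
no three of them are collinear, so that every `vᵢ` is a genuine vertex (the angle is less
than `π`). -/
structure ConvexPolygon where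
  /-- the number of vertices -/
  n : ℕ
  three_le : 3 ≤ n
  /-- the vertices, in counterclockwise order -/
  vertex : Fin n → Plane
  orient_pos : ∀ i j k : Fin n, i < j → j < k → 0 < orient (vertex i) (vertex j) (vertex k)

namespace ConvexPolygon

/-- The (closed) region bounded by the polygon. -/
def carrier (p : ConvexPolygon) : Set Plane :=
  convexHull ℝ (Set.range p.vertex)

/-- The edge from a vertex to the cyclically next one. -/
def edge (p : ConvexPolygon) (i : Fin p.n) : Set Plane :=
  segment ℝ (p.vertex i) (p.vertex (finRotate p.n i))

/-- The number of edges. -/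
noncomputable def numEdges (p : ConvexPolygon) : ℕ :=
  (Set.range p.edge).ncard

/-- The index of a polygon: the number of its edges minus six. -/
noncomputable def index (p : ConvexPolygon) : ℤ :=
  (p.numEdges : ℤ) - 6

/-- The area. -/
noncomputable def area (p : ConvexPolygon) : ℝ :=
  volume.real p.carrier

/-- The diameter. -/
noncomputable def diameter (p : ConvexPolygon) : ℝ :=
  Metric.diam p.carrier

/-- The polygon is regular, with centre at the origin. -/
def IsRegularCentred (p : ConvexPolygon) : Prop :=
  ∃ r θ : ℝ, 0 < r ∧ ∀ j : Fin p.n, p.vertex j =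
    !₂[r * Real.cos (θ + 2 * Real.pi * (j : ℕ) / p.n),
       r * Real.sin (θ + 2 * Real.pi * (j : ℕ) / p.n)]

theorem orient_ne_zero (p : ConvexPolygon) {i j k : Fin p.n} (hij : i ≠ j) (hik : i ≠ k)
    (hjk : j ≠ k) : orient (p.vertex i) (p.vertex j) (p.vertex k) ≠ 0 := by
  have h1 : ∀ a b c : Plane, orient a b c = - orient b a c := by
    intro a b c; unfold orient; ring
  have h2 : ∀ a b c : Plane, orient a b c = - orient a c b := by
    intro a b c; unfold orient; ring
  have key := p.orient_pos
  rcases lt_or_gt_of_ne hij with a | a <;> rcases lt_or_gt_of_ne hik with b | b <;>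
    rcases lt_or_gt_of_ne hjk with c | c
  · exact (key i j k a c).ne'
  · rw [h2]; exact neg_ne_zero.mpr (key i k j b c).ne'
  · exact absurd (a.trans c) (not_lt_of_gt b)
  · rw [h2, h1, neg_neg]; exact (key k i j b a).ne'
  · rw [h1]; exact neg_ne_zero.mpr (key j i k a b).ne'
  · exact absurd (b.trans c) (not_lt_of_gt a)
  · rw [h1, h2, neg_neg]; exact (key j k i c b).ne'
  · rw [h1, h2, h1]; simpa using (key k j i c a).ne'

theorem eq_or_eq_of_mem_edge (p : ConvexPolygon) {i j : Fin p.n} (h : p.vertex j ∈ p.edge i) :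
    j = i ∨ j = finRotate p.n i := by
  by_contra! hc
  obtain ⟨n, hn, v, hv⟩ := p
  obtain ⟨m, rfl⟩ : ∃ m, n = m + 3 := ⟨n - 3, by omega⟩
  have hne : i ≠ finRotate (m + 3) i := by
    rw [finRotate_apply]; intro h; simp at h
  refine orient_ne_zero ⟨m + 3, hn, v, hv⟩ hne hc.1.symm hc.2.symm ?_
  obtain ⟨a, b, -, -, hab, hx⟩ := h
  have hc0 := congrArg (fun z : Plane => z 0) hx
  have hc1 := congrArg (fun z : Plane => z 1) hx
  simp only [PiLp.add_apply, PiLp.smul_apply, smul_eq_mul] at hc0 hc1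
  simp only [orient, ← hc0, ← hc1]
  obtain rfl : a = 1 - b := by linarith
  ring

/-- An `n`-gon has exactly `n` edges. -/
theorem numEdges_eq (p : ConvexPolygon) : p.numEdges = p.n := by
  have hinj : Function.Injective p.edge := by
    intro i j hij
    have h1 : i = j ∨ i = finRotate p.n j :=
      p.eq_or_eq_of_mem_edge (hij ▸ left_mem_segment ℝ _ _)
    have h2 : j = i ∨ j = finRotate p.n i :=
      p.eq_or_eq_of_mem_edge (hij ▸ left_mem_segment ℝ _ _)
    obtain ⟨n, hn, v, hv⟩ := p
    obtain ⟨m, rfl⟩ : ∃ m, n = m + 3 := ⟨n - 3, by omega⟩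
    simp only [finRotate_apply] at h1 h2
    rcases h1 with h1 | h1
    · exact h1
    rcases h2 with h2 | h2
    · exact h2.symm
    exfalso
    have h3 : i + (1 + 1) = i + 0 := by
      rw [← add_assoc, ← h2, ← h1, add_zero]
    have h4 := congrArg Fin.val (add_left_cancel h3)
    simp only [Fin.val_add, Fin.val_one, Fin.val_zero] at h4
    rw [Nat.mod_eq_of_lt (by omega)] at h4
    omega
  rw [numEdges, ← Set.image_univ, Set.ncard_image_of_injective _ hinj, Set.ncard_univ]
  simp

end ConvexPolygon

/-- A tiling of the plane by convex polygons: the tiles cover the plane, and distinct tiles have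
disjoint interiors. -/
def IsTiling (F : Set ConvexPolygon) : Prop :=
  (⋃ p ∈ F, p.carrier) = Set.univ ∧
    ∀ p ∈ F, ∀ q ∈ F, p ≠ q → Disjoint (interior p.carrier) (interior q.carrier)

/-- Normality: for some positive `r` and `R`, every tile contains a disk of radius `r` and is
contained in a disk of radius `R`. -/
def IsNormal (F : Set ConvexPolygon) : Prop :=
  ∃ r R : ℝ, 0 < r ∧ 0 < R ∧ ∀ p ∈ F,
    (∃ x : Plane, Metric.closedBall x r ⊆ p.carrier) ∧
    (∃ y : Plane, p.carrier ⊆ Metric.closedBall y R)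

/-- The total index: the sum of the indices of all tiles. (It is a genuine sum if all but finitely
many tiles have index `0`.) -/
noncomputable def totalIndex (F : Set ConvexPolygon) : ℤ :=
  ∑ᶠ p ∈ F, p.index

/-! The rays through the corners of a regular `6k`-gon cut the plane into `6k` congruent sectors. In
a sector take the two adjacent corner vectors as basis; the integer points form a triangular lattice
whose triangles have area `1/6`. The lattice hexagons centred at the points `(m, n)` with `m ≡ n`
mod 3 tile a full plane, by `exists_cell` and `cell_unique`, and each consists of six triangles,
hence has area 1.

Restrict this tiling to each sector and glue along the rays. A cell centred on a ray is halved by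
it, and the two halves from adjacent sectors form a hexagon that is again convex, because
`corner_add_corner` expresses the bend by a factor `skew k` in `[1, 2)`. The triangles at the origin
form the `6k`-gon itself. The lemmas `mem_tileAt_of_inCell` and `exists_inCell_of_mem_tileAt`
translate between tiles and cells. Covering then follows from `exists_sector` and `exists_cell`;
disjointness is tested at a point off all lattice lines, where `sector_unique` and `cell_unique`
apply.

With `β = π/(3k)` and circumradius `ρ`, triangle area `1/6` means `ρ² sin β = 1/3`. Every tile lies
in a disk of radius `ρ` and the core has diameter `2ρ`, so `D = 2ρ`. The hexagons have area 1 and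
the core at least 1, so `A = 1`. Thus `2πD²/A = 8kβ / sin β`, which is asymptotic to `8k`, and
division by `6k - 6` gives `4/3`. -/

/-! ### Affine frames and the model hexagon -/

/-- The cross product of two plane vectors. -/
def cross (u w : Plane) : ℝ := u 0 * w 1 - u 1 * w 0

/-- The affine map `(s, t) ↦ o + s • u + t • w`. -/
noncomputable def frame (o u w : Plane) : ℝ × ℝ →ᵃ[ℝ] Plane :=
  ((LinearMap.fst ℝ ℝ ℝ).smulRight u + (LinearMap.snd ℝ ℝ ℝ).smulRight w).toAffineMap
    + AffineMap.const ℝ (ℝ × ℝ) o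

theorem frame_apply (o u w : Plane) (p : ℝ × ℝ) : frame o u w p = p.1 • u + p.2 • w + o := by
  simp [frame]

/-- The vertices of the model hexagon, in the coordinates of a frame. -/
def hexCoord (l : ℝ) : Fin 6 → ℝ × ℝ :=
  -- Only the lower two vertices depend on `l`. For `l = 1` this is the lattice hexagon; for `l =
  -- skew k` the last vertex points to the corner preceding `u`.
  ![(1, 0), (0, 1), (-1, 1), (-1, 0), (l - 1, -1), (l, -1)]

/-- The model hexagon. -/
def hexRegion (l : ℝ) : Set (ℝ × ℝ) :=
  {p | -1 ≤ p.2 ∧ p.2 ≤ 1 ∧ -1 ≤ p.1 ∧ -1 ≤ p.1 + l * p.2 ∧ p.1 + p.2 ≤ 1 ∧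
    p.1 + (l - 1) * p.2 ≤ 1}

theorem convex_hexRegion (l : ℝ) : Convex ℝ (hexRegion l) := by
  rintro ⟨x₁, x₂⟩ ⟨h1, h2, h3, h4, h5, h6⟩ ⟨y₁, y₂⟩ ⟨g1, g2, g3, g4, g5, g6⟩ a b ha hb hab
  obtain rfl : b = 1 - a := by linarith
  simp only [hexRegion, Set.mem_ofPred_eq, Prod.smul_mk, Prod.mk_add_mk, smul_eq_mul] at *
  refine ⟨?_, ?_, ?_, ?_, ?_, ?_⟩ <;> nlinarith

theorem Convex.mem_of_triangle {E : Type*} [AddCommGroup E] [Module ℝ E] {C : Set E}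
    (hC : Convex ℝ C) {o x y : E} (ho : o ∈ C) (hx : x ∈ C) (hy : y ∈ C) {s t : ℝ}
    (hs : 0 ≤ s) (ht : 0 ≤ t) (hst : s + t ≤ 1) : (1 - s - t) • o + s • x + t • y ∈ C := by
  have h := hC.sum_mem (t := Finset.univ) (w := ![1 - s - t, s, t]) (z := ![o, x, y])
    (by intro i _; fin_cases i <;> simp <;> linarith)
    (by simp [Fin.sum_univ_three]; ring)
    (by intro i _; fin_cases i <;> simpa)
  simpa [Fin.sum_univ_three] using h

/-- The hexagon is the union of six triangles joining the origin to its edges. The signs of `t` and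
of the linear forms vanishing on the diagonals select the triangle, and the forms supply the
coefficients. -/
theorem convexHull_hexCoord {l : ℝ} (h1 : 1 ≤ l) (h2 : l ≤ 2) :
    convexHull ℝ (Set.range (hexCoord l)) = hexRegion l := by
  apply Set.Subset.antisymm
  · refine convexHull_min ?_ (convex_hexRegion l)
    rintro _ ⟨i, rfl⟩
    fin_cases i <;> simp [hexCoord, hexRegion] <;> (try constructor) <;> linarith
  · rintro ⟨s, t⟩ ⟨a1, a2, a3, a4, a5, a6⟩
    simp only at a1 a2 a3 a4 a5 a6
    set C := convexHull ℝ (Set.range (hexCoord l))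
    have hC : Convex ℝ C := convex_convexHull ℝ _
    have hv : ∀ i, hexCoord l i ∈ C := fun i => subset_convexHull ℝ _ ⟨i, rfl⟩
    have v0 : ((1, 0) : ℝ × ℝ) ∈ C := hv 0
    have v1 : ((0, 1) : ℝ × ℝ) ∈ C := hv 1
    have v2 : ((-1, 1) : ℝ × ℝ) ∈ C := hv 2
    have v3 : ((-1, 0) : ℝ × ℝ) ∈ C := hv 3
    have v4 : ((l - 1, -1) : ℝ × ℝ) ∈ C := hv 4
    have v5 : ((l, -1) : ℝ × ℝ) ∈ C := hv 5
    have o : ((0, 0) : ℝ × ℝ) ∈ C := by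
      have := hC v0 v3 (a := 1 / 2) (b := 1 / 2) (by norm_num) (by norm_num) (by norm_num)
      simpa using this
    rcases le_total 0 t with ht | ht
    · rcases le_total 0 s with hs | hs
      · simpa using hC.mem_of_triangle o v0 v1 hs ht (by linarith)
      · rcases le_total 0 (s + t) with hst | hst
        · simpa using hC.mem_of_triangle o v2 v1 (s := -s) (t := s + t) (by linarith) hst
            (by linarith)
        · simpa using hC.mem_of_triangle o v2 v3 (s := t) (t := -s - t) ht (by linarith)
            (by linarith)
    · rcases le_total 0 (s + (l - 1) * t) with hs | hs
      · rcases le_total 0 (s + l * t) with hst | hst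
        · have := hC.mem_of_triangle o v0 v5 (s := s + l * t) (t := -t) hst (by linarith)
            (by linarith)
          convert this using 1
          ext <;> simp <;> ring
        · have := hC.mem_of_triangle o v5 v4 (s := s + (l - 1) * t) (t := - (s + l * t)) hs
            (by linarith) (by linarith)
          convert this using 1
          ext <;> simp <;> ring
      · have := hC.mem_of_triangle o v3 v4 (s := - (s + (l - 1) * t)) (t := -t) (by linarith)
            (by linarith) (by linarith)
        convert this using 1
        ext <;> simp <;> ring

theorem orient_frame (o u w : Plane) (p q r : ℝ × ℝ) :
    orient (frame o u w p) (frame o u w q) (frame o u w r) =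
      ((q.1 - p.1) * (r.2 - p.2) - (q.2 - p.2) * (r.1 - p.1)) * cross u w := by
  simp only [orient, frame_apply, cross, PiLp.add_apply, PiLp.smul_apply, smul_eq_mul]
  ring

/-- The image of the model hexagon in a positively oriented frame. -/
noncomputable def hexagon (o u w : Plane) (l : ℝ) (huw : 0 < cross u w) (h1 : 1 ≤ l)
    (h2 : l < 2) : ConvexPolygon where
  n := 6
  three_le := by norm_num
  vertex i := frame o u w (hexCoord l i)
  orient_pos i j k hij hjk := by
    rw [orient_frame]
    refine mul_pos ?_ huw
    fin_cases i <;> fin_cases j <;> first | (exfalso; revert hij; decide) | skip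
    all_goals fin_cases k <;> first | (exfalso; revert hjk; decide) | skip
    -- The strict bound `l < 2` is needed here: the vertices 0, 1, 5 give `2 - l`, so the angle at
    -- vertex 0 is less than `π`.
    all_goals simp [hexCoord] <;> nlinarith

section
variable {o u w : Plane} {l : ℝ} (huw : 0 < cross u w) (h1 : 1 ≤ l) (h2 : l < 2)

theorem carrier_hexagon :
    (hexagon o u w l huw h1 h2).carrier = frame o u w '' hexRegion l := by
  rw [← convexHull_hexCoord h1 h2.le, AffineMap.image_convexHull, ← Set.range_comp]
  rfl

end

/-! ### Area of a hexagon in a frame -/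

theorem integral_two_sub_abs : ∫ t in Set.Icc (-1 : ℝ) 1, (2 - |t|) = 3 := by
  rw [integral_Icc_eq_integral_Ioc, ← intervalIntegral.integral_of_le (by norm_num),
    ← intervalIntegral.integral_add_adjacent_intervals (b := 0)
      (by apply Continuous.intervalIntegrable; fun_prop)
      (by apply Continuous.intervalIntegrable; fun_prop)]
  have h1 : ∫ t in (-1 : ℝ)..0, (2 - |t|) = ∫ t in (-1 : ℝ)..0, (2 + t) := by
    refine intervalIntegral.integral_congr fun t ht => ?_
    rw [Set.uIcc_of_le (by norm_num)] at ht
    simp [abs_of_nonpos ht.2]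
  have h2 : ∫ t in (0 : ℝ)..1, (2 - |t|) = ∫ t in (0 : ℝ)..1, (2 - t) := by
    refine intervalIntegral.integral_congr fun t ht => ?_
    rw [Set.uIcc_of_le (by norm_num)] at ht
    simp [abs_of_nonneg ht.1]
  rw [h1, h2, intervalIntegral.integral_add (by simp) (by simp),
    intervalIntegral.integral_sub (by simp) (by simp)]
  simp
  norm_num

/-- Changing `l` only shears the lower half, so the slice at height `t` has length `2 - |t|`
whatever `l` is. -/
theorem volume_hexRegion {l : ℝ} (h1 : 1 ≤ l) (h2 : l ≤ 2) :
    volume (hexRegion l) = 3 := by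
  have hm : MeasurableSet (hexRegion l) := by
    have e : hexRegion l = {p | -1 ≤ p.2} ∩ {p | p.2 ≤ 1} ∩ {p | -1 ≤ p.1} ∩
        {p | -1 ≤ p.1 + l * p.2} ∩ {p | p.1 + p.2 ≤ 1} ∩ {p | p.1 + (l - 1) * p.2 ≤ 1} := by
      ext p; simp [hexRegion, and_assoc]
    rw [e]
    refine MeasurableSet.inter (.inter (.inter (.inter (.inter ?_ ?_) ?_) ?_) ?_) ?_ <;>
      exact measurableSet_le (by fun_prop) (by fun_prop)
  have hslice : ∀ t : ℝ, volume ((fun s => (s, t)) ⁻¹' hexRegion l) =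
      (Set.Icc (-1 : ℝ) 1).indicator (fun t => ENNReal.ofReal (2 - |t|)) t := by
    intro t
    by_cases ht : t ∈ Set.Icc (-1 : ℝ) 1
    · rw [Set.indicator_of_mem ht]
      obtain ⟨t1, t2⟩ := ht
      rcases le_total 0 t with h | h
      · have : (fun s => (s, t)) ⁻¹' hexRegion l = Set.Icc (-1) (1 - t) := by
          ext s
          simp only [hexRegion, Set.mem_preimage, Set.mem_ofPred_eq, Set.mem_Icc]
          constructor
          · rintro ⟨-, -, a, -, b, -⟩; exact ⟨a, by linarith⟩
          · rintro ⟨a, b⟩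
            refine ⟨t1, t2, a, ?_, by linarith, ?_⟩ <;> nlinarith
        rw [this, Real.volume_Icc, abs_of_nonneg h]
        ring_nf
      · have : (fun s => (s, t)) ⁻¹' hexRegion l = Set.Icc (-1 - l * t) (1 - (l - 1) * t) := by
          ext s
          simp only [hexRegion, Set.mem_preimage, Set.mem_ofPred_eq, Set.mem_Icc]
          constructor
          · rintro ⟨-, -, -, a, -, b⟩; exact ⟨by linarith, by linarith⟩
          · rintro ⟨a, b⟩
            refine ⟨t1, t2, ?_, by linarith, ?_, by linarith⟩ <;> nlinarith
        rw [this, Real.volume_Icc, abs_of_nonpos h]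
        ring_nf
    · rw [Set.indicator_of_notMem ht]
      convert measure_empty (μ := (volume : Measure ℝ))
      ext s
      simp only [hexRegion, Set.mem_preimage, Set.mem_ofPred_eq, Set.mem_empty_iff_false,
        iff_false]
      exact fun h => ht ⟨h.1, h.2.1⟩
  rw [Measure.volume_eq_prod, Measure.prod_apply_symm hm, lintegral_congr hslice,
    lintegral_indicator measurableSet_Icc, ← ofReal_integral_eq_lintegral_ofReal,
    integral_two_sub_abs]
  · simp
  · exact Continuous.integrableOn_Icc (by fun_prop)
  · filter_upwards [ae_restrict_mem measurableSet_Icc] with t ht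
    have := abs_le.2 ⟨ht.1, ht.2⟩
    simp only [Pi.zero_apply]
    linarith

/-- Up to a measure-preserving identification of `Plane` with `ℝ × ℝ`, a frame is a linear map of
determinant `cross u w` followed by a translation. -/
theorem volume_frame_image (o u w : Plane) (S : Set (ℝ × ℝ)) :
    volume (frame o u w '' S) = ENNReal.ofReal |cross u w| * volume S := by
  let e : Plane ≃ᵐ ℝ × ℝ :=
    (MeasurableEquiv.toLp 2 (Fin 2 → ℝ)).symm.trans MeasurableEquiv.finTwoArrow
  have he : MeasurePreserving e volume volume :=
    (PiLp.volume_preserving_ofLp (Fin 2)).trans (volume_preserving_finTwoArrow ℝ)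
  let A : Plane →ₗ[ℝ] Plane := Matrix.toLpLin 2 2 !![u 0, w 0; u 1, w 1]
  have hA : LinearMap.det A = cross u w := by
    simp only [A, Matrix.toLpLin_eq_toLin, LinearMap.det_toLin, Matrix.det_fin_two_of, cross]
    ring
  have himg : frame o u w '' S = (fun x => x + o) '' (A '' (e ⁻¹' S)) := by
    rw [Set.image_image, ← Set.image_preimage_eq S e.surjective, Set.image_image]
    simp only [e.surjective, Set.image_preimage_eq]
    refine Set.image_congr fun x _ => ?_
    rw [frame_apply]
    congr 1
    ext i
    fin_cases i <;> simp [A, e, Matrix.toLpLin_apply, dotProduct, mul_comm]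
  rw [himg, Set.image_add_right, measure_preimage_add_right, Measure.addHaar_image_linearMap, hA,
    he.measure_preimage_equiv]

section
variable {o u w : Plane} {l : ℝ} (huw : 0 < cross u w) (h1 : 1 ≤ l) (h2 : l < 2)

theorem area_hexagon : (hexagon o u w l huw h1 h2).area = 3 * cross u w := by
  rw [ConvexPolygon.area, carrier_hexagon, Measure.real, volume_frame_image,
    volume_hexRegion h1 h2.le, ENNReal.toReal_mul, abs_of_pos huw, ENNReal.toReal_ofReal huw.le]
  simp [mul_comm]

/-! ### Disks around and inside a hexagon -/

theorem carrier_hexagon_subset_closedBall {ρ : ℝ} (hu : ‖u‖ ≤ ρ) (hw : ‖w‖ ≤ ρ)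
    (hwu : ‖w - u‖ ≤ ρ) (hz : ‖l • u - w‖ ≤ ρ) (hzu : ‖(l - 1) • u - w‖ ≤ ρ) :
    (hexagon o u w l huw h1 h2).carrier ⊆ Metric.closedBall o ρ := by
  have key : ∀ i, ‖(hexCoord l i).1 • u + (hexCoord l i).2 • w‖ ≤ ρ := by
    intro i
    fin_cases i
    · simpa [hexCoord] using hu
    · simpa [hexCoord] using hw
    · simpa [hexCoord, neg_add_eq_sub] using hwu
    · simpa [hexCoord] using hu
    · simpa [hexCoord, ← sub_eq_add_neg] using hzu
    · simpa [hexCoord, ← sub_eq_add_neg] using hz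
  refine convexHull_min ?_ (convex_closedBall o ρ)
  rintro _ ⟨i, rfl⟩
  rw [mem_closedBall_iff_norm]
  change ‖frame o u w (hexCoord l i) - o‖ ≤ ρ
  rw [frame_apply, add_sub_cancel_right]
  exact key i

theorem abs_cross_le (x y : Plane) : |cross x y| ≤ ‖x‖ * ‖y‖ := by
  have hx : ‖x‖ ^ 2 = x 0 ^ 2 + x 1 ^ 2 := by simp [EuclideanSpace.norm_sq_eq]
  have hy : ‖y‖ ^ 2 = y 0 ^ 2 + y 1 ^ 2 := by simp [EuclideanSpace.norm_sq_eq]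
  refine abs_le_of_sq_le_sq ?_ (by positivity)
  rw [mul_pow, hx, hy, cross]
  nlinarith [sq_nonneg (x 0 * y 0 + x 1 * y 1)]

theorem frame_cross (huw : cross u w ≠ 0) (x : Plane) :
    frame o u w (cross (x - o) w / cross u w, cross u (x - o) / cross u w) = x := by
  rw [frame_apply]
  ext i
  fin_cases i
  · simp
    field_simp
    simp [cross]
    ring
  · simp
    field_simp
    simp [cross]
    ring

/-- By Cramer's rule the frame coordinates of a point of the disk are at most `(1/9) / (1/3) = 1/3`
in absolute value. Since `l < 2`, even `s + l t` then stays within `[-1, 1]`. -/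
theorem closedBall_subset_carrier_hexagon {ρ : ℝ} (hρ : 0 < ρ) (hu : ‖u‖ ≤ ρ) (hw : ‖w‖ ≤ ρ)
    (hc : 1 / 3 ≤ cross u w) :
    Metric.closedBall o (1 / (9 * ρ)) ⊆ (hexagon o u w l huw h1 h2).carrier := by
  intro x hx
  rw [mem_closedBall_iff_norm] at hx
  rw [carrier_hexagon]
  refine ⟨_, ?_, frame_cross huw.ne' x⟩
  have hb : ∀ c : ℝ, |c| ≤ 1 / (9 * ρ) * ρ → |c / cross u w| ≤ 1 / 3 := by
    intro c h
    have : 1 / (9 * ρ) * ρ = 1 / 9 := by field_simp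
    rw [abs_div, abs_of_pos huw, div_le_iff₀ huw]
    linarith
  have hs := hb (cross (x - o) w) ((abs_cross_le _ _).trans (by gcongr))
  have ht := hb (cross u (x - o)) ((abs_cross_le _ _).trans (by rw [mul_comm]; gcongr))
  rw [abs_le] at hs ht
  simp only [hexRegion, Set.mem_ofPred_eq]
  refine ⟨?_, ?_, ?_, ?_, ?_, ?_⟩ <;> nlinarith

end

/-! ### The corners of the regular `6k`-gon -/

/-- The central angle over an edge of the regular `6k`-gon. -/
noncomputable def stepAngle (k : ℕ) : ℝ := Real.pi / (3 * k)

/-- The circumradius of the regular `6k`-gon of area `k`. -/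
noncomputable def circumradius (k : ℕ) : ℝ := √(1 / (3 * Real.sin (stepAngle k)))

/-- The vertices of the regular `6k`-gon of area `k` (periodic in `j`). -/
noncomputable def corner (k : ℕ) (j : ℤ) : Plane :=
  !₂[circumradius k * Real.cos (stepAngle k * j), circumradius k * Real.sin (stepAngle k * j)]

/-- The skewness of the hexagons that are cut by a boundary ray of a sector. -/
noncomputable def skew (k : ℕ) : ℝ := 2 * Real.cos (stepAngle k)

/-- For three points on a circle, `orient` is the squared radius times the left side. The product
form makes its sign visible, which gives both the convexity of the core and its supporting lines. -/
theorem sin_add_sin_sub_sin_add (p q : ℝ) : Real.sin p + Real.sin q - Real.sin (p + q) =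
    4 * Real.sin (p / 2) * Real.sin (q / 2) * Real.sin ((p + q) / 2) := by
  obtain ⟨a, rfl⟩ : ∃ a, p = 2 * a := ⟨p / 2, by ring⟩
  obtain ⟨b, rfl⟩ : ∃ b, q = 2 * b := ⟨q / 2, by ring⟩
  have e : (2 * a + 2 * b) / 2 = a + b := by ring
  have e1 : 2 * a / 2 = a := by ring
  have e2 : 2 * b / 2 = b := by ring
  rw [e, e1, e2, Real.sin_add (2 * a), Real.sin_add a, Real.sin_two_mul, Real.sin_two_mul,
    Real.cos_two_mul', Real.cos_two_mul']
  have ha := Real.sin_sq_add_cos_sq a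
  have hb := Real.sin_sq_add_cos_sq b
  linear_combination (-2 * Real.sin b * Real.cos b) * ha + (-2 * Real.sin a * Real.cos a) * hb

theorem stepAngle_pos {k : ℕ} (hk : 1 ≤ k) : 0 < stepAngle k := by
  have : (1 : ℝ) ≤ k := by exact_mod_cast hk
  have := Real.pi_pos
  unfold stepAngle; positivity

theorem mul_stepAngle {k : ℕ} (hk : 1 ≤ k) : stepAngle k * (3 * k) = Real.pi := by
  have : (1 : ℝ) ≤ k := by exact_mod_cast hk
  unfold stepAngle; field_simp

theorem stepAngle_le {k : ℕ} (hk : 1 ≤ k) : stepAngle k ≤ Real.pi / 3 := by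
  have h : (1 : ℝ) ≤ k := by exact_mod_cast hk
  have := mul_stepAngle hk
  nlinarith [stepAngle_pos hk]

theorem sin_stepAngle_pos {k : ℕ} (hk : 1 ≤ k) : 0 < Real.sin (stepAngle k) :=
  Real.sin_pos_of_pos_of_lt_pi (stepAngle_pos hk) (by linarith [stepAngle_le hk, Real.pi_pos])

theorem half_le_cos_stepAngle {k : ℕ} (hk : 1 ≤ k) : 1 / 2 ≤ Real.cos (stepAngle k) := by
  rw [← Real.cos_pi_div_three]
  exact Real.cos_le_cos_of_nonneg_of_le_pi (stepAngle_pos hk).le (by linarith [Real.pi_pos])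
    (stepAngle_le hk)

theorem one_le_skew {k : ℕ} (hk : 1 ≤ k) : 1 ≤ skew k := by
  have := half_le_cos_stepAngle hk
  unfold skew; linarith

theorem skew_lt_two {k : ℕ} (hk : 1 ≤ k) : skew k < 2 := by
  have h1 := sin_stepAngle_pos hk
  have h2 := Real.sin_sq_add_cos_sq (stepAngle k)
  unfold skew; nlinarith

theorem circumradius_pos {k : ℕ} (hk : 1 ≤ k) : 0 < circumradius k := by
  have := sin_stepAngle_pos hk
  unfold circumradius; positivity

theorem circumradius_sq {k : ℕ} (hk : 1 ≤ k) :
    circumradius k ^ 2 = 1 / (3 * Real.sin (stepAngle k)) := by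
  have := sin_stepAngle_pos hk
  rw [circumradius, Real.sq_sqrt (by positivity)]

theorem cross_corner (k : ℕ) (i j : ℤ) : cross (corner k i) (corner k j) =
    circumradius k ^ 2 * Real.sin (stepAngle k * (j - i)) := by
  rw [mul_sub, Real.sin_sub]
  simp [cross, corner]
  ring

theorem cross_corner_succ {k : ℕ} (hk : 1 ≤ k) (j : ℤ) :
    cross (corner k j) (corner k (j + 1)) = 1 / 3 := by
  have := sin_stepAngle_pos hk
  rw [cross_corner, circumradius_sq hk]
  push_cast
  rw [add_sub_cancel_left, mul_one]
  field_simp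

theorem norm_corner {k : ℕ} (hk : 1 ≤ k) (j : ℤ) : ‖corner k j‖ = circumradius k := by
  have h : ‖corner k j‖ ^ 2 = circumradius k ^ 2 := by
    simp only [corner, EuclideanSpace.norm_sq_eq, Fin.sum_univ_two, Real.norm_eq_abs, sq_abs]
    simp
    linear_combination circumradius k ^ 2 * Real.sin_sq_add_cos_sq (stepAngle k * j)
  exact (pow_left_inj₀ (norm_nonneg _) (circumradius_pos hk).le two_ne_zero).1 h

theorem norm_corner_succ_sub {k : ℕ} (hk : 1 ≤ k) (j : ℤ) :
    ‖corner k (j + 1) - corner k j‖ ≤ circumradius k := by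
  refine le_of_sq_le_sq ?_ (circumradius_pos hk).le
  have e : ‖corner k (j + 1) - corner k j‖ ^ 2 =
      circumradius k ^ 2 * (2 - 2 * Real.cos (stepAngle k)) := by
    simp only [corner, EuclideanSpace.norm_sq_eq, Fin.sum_univ_two, Real.norm_eq_abs, sq_abs]
    simp
    have h1 := Real.sin_sq_add_cos_sq (stepAngle k * j)
    have h2 := Real.sin_sq_add_cos_sq (stepAngle k * (j + 1))
    have h3 : Real.cos (stepAngle k) = Real.cos (stepAngle k * (j + 1) - stepAngle k * j) := by
      congr 1; ring
    rw [h3, Real.cos_sub]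
    linear_combination circumradius k ^ 2 * (h1 + h2)
  rw [e]
  have := half_le_cos_stepAngle hk
  nlinarith [sq_nonneg (circumradius k)]

/-- This is the change of frame between adjacent sectors; it is what allows half-cells on the two
sides of a ray to be glued. -/
theorem corner_add_corner (k : ℕ) (j : ℤ) :
    corner k j + corner k (j + 2) = skew k • corner k (j + 1) := by
  have e0 : stepAngle k * j = stepAngle k * (j + 1) - stepAngle k := by ring
  have e2 : stepAngle k * (j + 2) = stepAngle k * (j + 1) + stepAngle k := by ring
  ext i
  fin_cases i
  · simp [corner, skew]
    rw [e0, e2, Real.cos_sub, Real.cos_add]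
    ring
  · simp [corner, skew]
    rw [e0, e2, Real.sin_sub, Real.sin_add]
    ring

theorem corner_add_three_mul {k : ℕ} (hk : 1 ≤ k) (j : ℤ) :
    corner k (j + 3 * k) = -corner k j := by
  have e : stepAngle k * (j + 3 * k) = stepAngle k * j + Real.pi := by
    rw [← mul_stepAngle hk]; ring
  ext i
  fin_cases i <;> simp [corner, e, Real.cos_add_pi, Real.sin_add_pi]

theorem corner_add_two_mul {k : ℕ} (hk : 1 ≤ k) (j : ℤ) :
    corner k (j + 2 * k) = corner k (j + k) - corner k j := by
  have e : stepAngle k * (j + k) = stepAngle k * j + Real.pi / 3 := by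
    rw [← mul_stepAngle hk]; ring
  have e1 : stepAngle k * (j + 2 * k) = stepAngle k * j + Real.pi / 3 + Real.pi / 3 := by
    rw [← mul_stepAngle hk]; ring
  have h3 : √3 * √3 = 3 := Real.mul_self_sqrt (by norm_num)
  ext i
  fin_cases i
  · simp [corner, e, e1, Real.cos_add, Real.sin_add]
    linear_combination (-circumradius k * Real.cos (stepAngle k * j) / 4) * h3
  · simp [corner, e, e1, Real.cos_add, Real.sin_add]
    linear_combination (-circumradius k * Real.sin (stepAngle k * j) / 4) * h3

theorem corner_add_period {k : ℕ} (hk : 1 ≤ k) (j m : ℤ) :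
    corner k (j + 6 * k * m) = corner k j := by
  have e : stepAngle k * (j + 6 * k * m) = stepAngle k * j + m * (2 * Real.pi) := by
    rw [← mul_stepAngle hk]; ring
  simp [corner, e, Real.cos_add_int_mul_two_pi, Real.sin_add_int_mul_two_pi]

/-! ### The decomposition into sectors -/

/-- Every point of the plane lies in one of the sectors. -/
theorem exists_sector {k : ℕ} (hk : 1 ≤ k) (x : Plane) : ∃ (j : ℤ) (a b : ℝ), 0 ≤ a ∧ 0 ≤ b ∧
    x = a • corner k j + b • corner k (j + 1) := by
  obtain ⟨r, θ, hr, h0, h1⟩ : ∃ r θ : ℝ, 0 ≤ r ∧ x 0 = r * Real.cos θ ∧ x 1 = r * Real.sin θ :=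
    ⟨_, _, norm_nonneg _, (Complex.norm_mul_cos_arg ⟨x 0, x 1⟩).symm,
      (Complex.norm_mul_sin_arg ⟨x 0, x 1⟩).symm⟩
  have hβ := stepAngle_pos hk
  have hs := sin_stepAngle_pos hk
  have hρ := circumradius_pos hk
  have hπ : stepAngle k ≤ Real.pi := by linarith [stepAngle_le hk, Real.pi_pos]
  set j := ⌊θ / stepAngle k⌋ with hj
  have l1 : stepAngle k * j ≤ θ := by
    have := Int.floor_le (θ / stepAngle k)
    rw [le_div_iff₀ hβ] at this; linarith
  have l2 : θ ≤ stepAngle k * (j + 1) := by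
    have := Int.lt_floor_add_one (θ / stepAngle k)
    rw [div_lt_iff₀ hβ] at this; linarith
  -- The law of sines gives the coefficients along the two rays; both are nonnegative since `θ` lies
  -- between the two angles.
  refine ⟨j, r * Real.sin (stepAngle k * (j + 1) - θ) / (circumradius k * Real.sin (stepAngle k)),
    r * Real.sin (θ - stepAngle k * j) / (circumradius k * Real.sin (stepAngle k)), ?_, ?_, ?_⟩
  · have := Real.sin_nonneg_of_nonneg_of_le_pi (x := stepAngle k * (j + 1) - θ) (by linarith)
      (by linarith)
    positivity
  · have := Real.sin_nonneg_of_nonneg_of_le_pi (x := θ - stepAngle k * j) (by linarith)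
      (by linarith)
    positivity
  · have e : Real.sin (stepAngle k) =
        Real.sin (stepAngle k * (j + 1) - stepAngle k * j) := by congr 1; ring
    ext i
    fin_cases i
    · simp [corner, h0]
      field_simp
      rw [e, Real.sin_sub, Real.sin_sub, Real.sin_sub]
      ring
    · simp [corner, h1]
      field_simp
      rw [e, Real.sin_sub, Real.sin_sub, Real.sin_sub]
      ring

theorem sin_mul_pos {k : ℕ} (hk : 1 ≤ k) {d : ℤ} (h0 : 0 < d) (h1 : d < 3 * k) :
    0 < Real.sin (stepAngle k * d) := by
  have hβ := stepAngle_pos hk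
  have h0' : (0 : ℝ) < d := by exact_mod_cast h0
  have h1' : (d : ℝ) < 3 * k := by exact_mod_cast h1
  refine Real.sin_pos_of_pos_of_lt_pi (by positivity) ?_
  rw [← mul_stepAngle hk]
  gcongr

theorem sin_mul_nonneg {k : ℕ} (hk : 1 ≤ k) {d : ℤ} (h0 : 0 ≤ d) (h1 : d ≤ 3 * k) :
    0 ≤ Real.sin (stepAngle k * d) := by
  have hβ := stepAngle_pos hk
  have h0' : (0 : ℝ) ≤ d := by exact_mod_cast h0
  have h1' : (d : ℝ) ≤ 3 * k := by exact_mod_cast h1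
  refine Real.sin_nonneg_of_nonneg_of_le_pi (by positivity) ?_
  rw [← mul_stepAngle hk]
  gcongr

theorem sin_mul_add_half {k : ℕ} (hk : 1 ≤ k) (d : ℤ) :
    Real.sin (stepAngle k * (d + 3 * k : ℤ)) = -Real.sin (stepAngle k * d) := by
  rw [← Real.sin_add_pi, ← mul_stepAngle hk]
  push_cast
  congr 1; ring

/-- The interior of a sector meets no other sector. -/
theorem sector_unique {k : ℕ} (hk : 1 ≤ k) {i j : ℤ} {a b a' b' : ℝ} (ha : 0 < a) (hb : 0 < b)
    (ha' : 0 ≤ a') (hb' : 0 ≤ b')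
    (h : a • corner k i + b • corner k (i + 1) = a' • corner k j + b' • corner k (j + 1)) :
    (∃ m : ℤ, i = j + 6 * k * m) ∧ a = a' ∧ b = b' := by
  have hρ : 0 < circumradius k ^ 2 := pow_pos (circumradius_pos hk) 2
  have self : ∀ y : Plane, cross y y = 0 := fun y => by simp [cross, mul_comm]
  have anti : ∀ y z : Plane, cross y z = - cross z y := fun y z => by simp [cross]; ring
  have key : ∃ m : ℤ, i = j + 6 * k * m := by
    -- The residue `d` is the number of sectors between the two. Crossing the equation with the two
    -- corners bounding sector `j` gives one sign condition each, `n1` and `n2`; for `0 < d ≤ 3k`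
    -- the second fails, for larger `d` the first.
    obtain ⟨d, m, hd0, hd1, hd⟩ : ∃ d m : ℤ, 0 ≤ d ∧ d < 6 * k ∧ i = j + 6 * k * m + d :=
      ⟨(i - j) % (6 * k), (i - j) / (6 * k), Int.emod_nonneg _ (by lia),
        Int.emod_lt_of_pos _ (by lia), by linarith [Int.emod_add_mul_ediv (i - j) (6 * k)]⟩
    refine ⟨m, ?_⟩
    suffices d = 0 by lia
    have p0 : corner k i = corner k (j + d) := by
      rw [← corner_add_period hk (j + d) m, hd]; congr 1; ring
    have p1 : corner k (i + 1) = corner k (j + (d + 1)) := by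
      rw [← corner_add_period hk (j + (d + 1)) m, hd]; congr 1; ring
    rw [p0, p1] at h
    have c1 := congrArg (cross (corner k j)) h
    have c2 := congrArg (cross (corner k (j + 1))) h
    have lin : ∀ (y u w : Plane) (s t : ℝ), cross y (s • u + t • w) =
        s * cross y u + t * cross y w := fun y u w s t => by simp [cross]; ring
    rw [lin, lin, self, cross_corner_succ hk, cross_corner, cross_corner] at c1
    rw [lin, lin, self, anti (corner k (j + 1)) (corner k j), cross_corner_succ hk,
      cross_corner, cross_corner] at c2
    have n1 : 0 ≤ a * Real.sin (stepAngle k * d) + b * Real.sin (stepAngle k * (d + 1 : ℤ)) := by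
      have : circumradius k ^ 2 *
          (a * Real.sin (stepAngle k * d) + b * Real.sin (stepAngle k * (d + 1 : ℤ))) =
          b' * (1 / 3) := by
        push_cast at c1 ⊢
        simp only [add_sub_cancel_left] at c1
        linarith
      by_contra! hneg
      nlinarith
    have n2 : a * Real.sin (stepAngle k * (d - 1 : ℤ)) + b * Real.sin (stepAngle k * d) ≤ 0 := by
      have : circumradius k ^ 2 *
          (a * Real.sin (stepAngle k * (d - 1 : ℤ)) + b * Real.sin (stepAngle k * d)) =
          - (a' * (1 / 3)) := by
        push_cast at c2 ⊢
        have e1 : (j : ℝ) + d - (j + 1) = d - 1 := by ring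
        have e2 : (j : ℝ) + (d + 1) - (j + 1) = d := by ring
        rw [e1, e2] at c2
        linarith
      by_contra! hneg
      nlinarith
    by_contra hne
    rcases lt_trichotomy d (3 * k) with hlt | heq | hgt
    · have s1 := sin_mul_pos hk (d := d) (by lia) hlt
      have s2 := sin_mul_nonneg hk (d := d - 1) (by lia) (by lia)
      nlinarith [mul_pos hb s1, mul_nonneg ha.le s2]
    · have s1 := sin_mul_nonneg hk (d := d) (by lia) (by lia)
      have s2 := sin_mul_pos hk (d := d - 1) (by lia) (by lia)
      nlinarith [mul_nonneg hb.le s1, mul_pos ha s2]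
    · have s1 := sin_mul_pos hk (d := d - 3 * k) (by lia) (by lia)
      have s2 := sin_mul_nonneg hk (d := d + 1 - 3 * k) (by lia) (by lia)
      have t1 := sin_mul_add_half hk (d - 3 * k)
      have t2 := sin_mul_add_half hk (d + 1 - 3 * k)
      rw [sub_add_cancel] at t1 t2
      nlinarith [mul_nonneg hb.le s2, mul_pos ha s1]
  refine ⟨key, ?_⟩
  obtain ⟨m, rfl⟩ := key
  have p1 : corner k (j + 6 * k * m + 1) = corner k (j + 1) := by
    rw [← corner_add_period hk (j + 1) m]; congr 1; ring
  rw [corner_add_period hk, p1] at h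
  have c1 := congrArg (cross (corner k j)) h
  have c2 := congrArg (cross (corner k (j + 1))) h
  have lin : ∀ (y u w : Plane) (s t : ℝ), cross y (s • u + t • w) =
      s * cross y u + t * cross y w := fun y u w s t => by simp [cross]; ring
  rw [lin, lin, self, cross_corner_succ hk] at c1
  rw [lin, lin, self, anti (corner k (j + 1)) (corner k j), cross_corner_succ hk] at c2
  constructor <;> linarith

/-! ### The central `6k`-gon -/

/-- The regular `6k`-gon of area `k` centred at the origin. -/
noncomputable def core {k : ℕ} (hk : 1 ≤ k) : ConvexPolygon where
  n := 6 * k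
  three_le := by lia
  vertex j := corner k (j : ℕ)
  orient_pos i j l hij hjl := by
    have e : ∀ x y z : Plane, orient x y z = cross x y + cross y z - cross x z := fun x y z => by
      simp [orient, cross]; ring
    have hβ := stepAngle_pos hk
    have hπ := mul_stepAngle hk
    have h1 : (1 : ℝ) ≤ (j : ℕ) - (i : ℕ) := by
      have : (i : ℕ) + 1 ≤ (j : ℕ) := hij
      have : ((i : ℕ) : ℝ) + 1 ≤ (j : ℕ) := by exact_mod_cast this
      linarith
    have h2 : (1 : ℝ) ≤ (l : ℕ) - (j : ℕ) := by
      have : (j : ℕ) + 1 ≤ (l : ℕ) := hjl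
      have : ((j : ℕ) : ℝ) + 1 ≤ (l : ℕ) := by exact_mod_cast this
      linarith
    have h3 : ((l : ℕ) : ℝ) + 1 ≤ 6 * k := by
      have : (l : ℕ) + 1 ≤ 6 * k := l.2
      exact_mod_cast this
    have h4 : (0 : ℝ) ≤ (i : ℕ) := by positivity
    have f : stepAngle k * ((l : ℕ) - (i : ℕ)) =
        stepAngle k * ((j : ℕ) - (i : ℕ)) + stepAngle k * ((l : ℕ) - (j : ℕ)) := by ring
    rw [e, cross_corner, cross_corner, cross_corner, ← mul_add, ← mul_sub]
    refine mul_pos (pow_pos (circumradius_pos hk) 2) ?_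
    push_cast
    rw [f, sin_add_sin_sub_sin_add]
    have s : ∀ x : ℝ, 0 < x → x < 2 * Real.pi → 0 < Real.sin (x / 2) := fun x h h' =>
      Real.sin_pos_of_pos_of_lt_pi (by linarith) (by linarith)
    have s1 := s (stepAngle k * ((j : ℕ) - (i : ℕ))) (by nlinarith) (by nlinarith)
    have s2 := s (stepAngle k * ((l : ℕ) - (j : ℕ))) (by nlinarith) (by nlinarith)
    have s3 := s (stepAngle k * ((j : ℕ) - (i : ℕ)) + stepAngle k * ((l : ℕ) - (j : ℕ)))
      (by nlinarith) (by nlinarith)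
    positivity

section
variable {k : ℕ} (hk : 1 ≤ k)

theorem convex_carrier (p : ConvexPolygon) : Convex ℝ p.carrier := convex_convexHull ℝ _

theorem corner_mem_core (j : ℤ) : corner k j ∈ (core hk).carrier := by
  have hk' : (0 : ℤ) < 6 * k := by lia
  have h0 := Int.emod_nonneg j hk'.ne'
  have h1 := Int.emod_lt_of_pos j hk'
  refine subset_convexHull ℝ _ ⟨⟨(j % (6 * k)).toNat, by simp only [core]; lia⟩, ?_⟩
  have : j = j % (6 * k) + 6 * k * (j / (6 * k)) := (Int.emod_add_mul_ediv j (6 * k)).symm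
  conv_rhs => rw [this, corner_add_period hk]
  simp only [core]
  congr 1
  lia

theorem zero_mem_core : (0 : Plane) ∈ (core hk).carrier := by
  have h0 := corner_mem_core hk 0
  have h1 := corner_mem_core hk (0 + 3 * k)
  rw [corner_add_three_mul hk] at h1
  have := convex_carrier (core hk) h0 h1 (a := 1 / 2) (b := 1 / 2) (by norm_num) (by norm_num)
    (by norm_num)
  simpa using this

theorem mem_core {j : ℤ} {a b : ℝ} (ha : 0 ≤ a) (hb : 0 ≤ b) (hab : a + b ≤ 1) :
    a • corner k j + b • corner k (j + 1) ∈ (core hk).carrier := by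
  simpa using (convex_carrier (core hk)).mem_of_triangle (zero_mem_core hk) (corner_mem_core hk j)
    (corner_mem_core hk (j + 1)) ha hb hab

theorem core_subset_closedBall : (core hk).carrier ⊆ Metric.closedBall 0 (circumradius k) := by
  refine convexHull_min ?_ (convex_closedBall _ _)
  rintro _ ⟨i, rfl⟩
  rw [mem_closedBall_zero_iff]
  exact (norm_corner hk _).le

/-- The line through two adjacent corners supports the core: the half-plane `H` contains every
corner, hence their hull. -/
theorem add_le_one_of_mem_core {j : ℤ} {a b : ℝ}
    (h : a • corner k j + b • corner k (j + 1) ∈ (core hk).carrier) : a + b ≤ 1 := by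
  let H : Set Plane := {y | cross (corner k j) y + cross y (corner k (j + 1)) ≤ 1 / 3}
  have hH : Convex ℝ H := by
    intro x hx y hy s t hs ht hst
    obtain rfl : t = 1 - s := by linarith
    simp only [H, Set.mem_ofPred_eq, cross, PiLp.add_apply, PiLp.smul_apply, smul_eq_mul] at *
    nlinarith
  have hsub : (core hk).carrier ⊆ H := by
    refine convexHull_min ?_ hH
    rintro _ ⟨i, rfl⟩
    change cross (corner k j) (corner k (i : ℕ)) + cross (corner k (i : ℕ)) (corner k (j + 1)) ≤ _
    have hk' : (0 : ℤ) < 6 * k := by lia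
    set i' : ℤ := ((i : ℕ) : ℤ)
    -- Residues are taken in `1, …, 6k` so that both `d` and `d - 1` steps make an angle in `[0,
    -- 2π]`, where the half-angle sines are nonnegative.
    obtain ⟨d, m, hd0, hd1, hd⟩ : ∃ d m : ℤ, 1 ≤ d ∧ d ≤ 6 * k ∧ i' = j + d + 6 * k * m := by
      refine ⟨(i' - j - 1) % (6 * k) + 1, (i' - j - 1) / (6 * k), ?_, ?_, ?_⟩
      · have := Int.emod_nonneg (i' - j - 1) hk'.ne'
        lia
      · have := Int.emod_lt_of_pos (i' - j - 1) hk'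
        lia
      · have := Int.emod_add_mul_ediv (i' - j - 1) (6 * k)
        linarith
    rw [hd, corner_add_period hk, ← cross_corner_succ hk j, cross_corner, cross_corner,
      cross_corner, ← mul_add]
    refine mul_le_mul_of_nonneg_left ?_ (sq_nonneg _)
    have hd0' : (1 : ℝ) ≤ d := by exact_mod_cast hd0
    have hd1' : (d : ℝ) ≤ 6 * k := by exact_mod_cast hd1
    have hβ := stepAngle_pos hk
    have hπ := mul_stepAngle hk
    have key := sin_add_sin_sub_sin_add (stepAngle k) (stepAngle k * (d - 1))
    have s : ∀ x : ℝ, 0 ≤ x → x ≤ 2 * Real.pi → 0 ≤ Real.sin (x / 2) := fun x h h' =>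
      Real.sin_nonneg_of_nonneg_of_le_pi (by linarith) (by linarith)
    have s1 := s (stepAngle k) hβ.le (by nlinarith)
    have s2 := s (stepAngle k * (d - 1)) (by nlinarith) (by nlinarith)
    have s3 := s (stepAngle k + stepAngle k * (d - 1)) (by nlinarith) (by nlinarith)
    have hp : 0 ≤ 4 * Real.sin (stepAngle k / 2) * Real.sin (stepAngle k * (d - 1) / 2) *
      Real.sin ((stepAngle k + stepAngle k * (d - 1)) / 2) := by positivity
    rw [← key] at hp
    have e1 : stepAngle k + stepAngle k * (d - 1) = stepAngle k * d := by ring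
    have e2 : stepAngle k * (((j + 1 : ℤ) : ℝ) - (j + d : ℤ)) = -(stepAngle k * (d - 1)) := by
      push_cast; ring
    have e3 : stepAngle k * (((j + d : ℤ) : ℝ) - j) = stepAngle k * d := by push_cast; ring
    have e4 : stepAngle k * (((j + 1 : ℤ) : ℝ) - j) = stepAngle k := by push_cast; ring
    rw [e2, e3, e4, Real.sin_neg]
    rw [e1] at hp
    linarith
  have := hsub h
  have c := cross_corner_succ hk j
  have e : cross (corner k j) (a • corner k j + b • corner k (j + 1)) +
      cross (a • corner k j + b • corner k (j + 1)) (corner k (j + 1)) =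
      (a + b) * cross (corner k j) (corner k (j + 1)) := by
    simp [cross]; ring
  simp only [H, Set.mem_ofPred_eq] at this
  rw [e, c] at this
  linarith

/-- The corners `0` and `k` subtend the angle `π/3`, which is at least one step, and `sin` is
monotone there. Hence the inscribed regular hexagon has area at least 1. -/
theorem one_third_le_cross_corner {k : ℕ} (hk : 1 ≤ k) : 1 / 3 ≤ cross (corner k 0) (corner k k) := by
  rw [cross_corner, circumradius_sq hk]
  have e : stepAngle k * (((k : ℤ) : ℝ) - (0 : ℤ)) = Real.pi / 3 := by
    rw [← mul_stepAngle hk]; push_cast; ring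
  have h := sin_stepAngle_pos hk
  have : Real.sin (stepAngle k) ≤ Real.sin (Real.pi / 3) :=
    Real.sin_le_sin_of_le_of_le_pi_div_two (by linarith [stepAngle_pos hk, Real.pi_pos])
      (by linarith [Real.pi_pos]) (stepAngle_le hk)
  rw [e, one_div_mul_eq_div, le_div_iff₀ (by positivity)]
  linarith

/-- A regular hexagon inscribed in the regular `6k`-gon. -/
noncomputable def inscribedHexagon : ConvexPolygon :=
  hexagon 0 (corner k 0) (corner k k) 1 (by linarith [one_third_le_cross_corner hk]) le_rfl
    (by norm_num)

theorem inscribedHexagon_subset_core : (inscribedHexagon hk).carrier ⊆ (core hk).carrier := by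
  have h2 := corner_add_two_mul hk 0
  have h3 := corner_add_three_mul hk 0
  have h4 := corner_add_three_mul hk k
  have h5 := corner_add_three_mul hk (0 + 2 * k)
  rw [h2] at h5
  simp only [zero_add, neg_sub] at h2 h3 h4 h5
  have key : ∀ i, (hexCoord 1 i).1 • corner k 0 + (hexCoord 1 i).2 • corner k k ∈
      (core hk).carrier := by
    intro i
    fin_cases i
    · simpa [hexCoord] using corner_mem_core hk 0
    · simpa [hexCoord] using corner_mem_core hk k
    · simpa [hexCoord, neg_add_eq_sub, h2] using corner_mem_core hk (2 * k)
    · simpa [hexCoord, h3] using corner_mem_core hk (3 * k)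
    · simpa [hexCoord, h4] using corner_mem_core hk (k + 3 * k)
    · simpa [hexCoord, ← sub_eq_add_neg, h5] using corner_mem_core hk (2 * k + 3 * k)
  refine convexHull_min ?_ (convex_carrier _)
  rintro _ ⟨i, rfl⟩
  change frame 0 (corner k 0) (corner k k) (hexCoord 1 i) ∈ _
  rw [frame_apply, add_zero]
  exact key i

theorem closedBall_subset_core :
    Metric.closedBall 0 (1 / (9 * circumradius k)) ⊆ (core hk).carrier :=
  (closedBall_subset_carrier_hexagon _ _ _ (circumradius_pos hk) (norm_corner hk _).le
    (norm_corner hk _).le (one_third_le_cross_corner hk)).trans (inscribedHexagon_subset_core hk)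

/-- Only a lower bound is needed for the minimal area, so the inscribed hexagon suffices and the
exact area of the core is never computed. -/
theorem one_le_area_core : 1 ≤ (core hk).area := by
  have h : (inscribedHexagon hk).area ≤ (core hk).area := by
    refine measureReal_mono (inscribedHexagon_subset_core hk) ?_
    exact ((Metric.isBounded_closedBall.subset (core_subset_closedBall hk)).measure_lt_top).ne
  rw [inscribedHexagon, area_hexagon] at h
  linarith [one_third_le_cross_corner hk]

theorem diameter_le_of_subset_closedBall (p : ConvexPolygon) {o : Plane} {ρ : ℝ} (hρ : 0 ≤ ρ)
    (h : p.carrier ⊆ Metric.closedBall o ρ) : p.diameter ≤ 2 * ρ :=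
  (Metric.diam_mono h Metric.isBounded_closedBall).trans (Metric.diam_closedBall hρ)

theorem diameter_core : (core hk).diameter = 2 * circumradius k := by
  have hρ := circumradius_pos hk
  refine le_antisymm (diameter_le_of_subset_closedBall _ hρ.le (core_subset_closedBall hk)) ?_
  have := Metric.dist_le_diam_of_mem (Metric.isBounded_closedBall.subset (core_subset_closedBall hk))
    (corner_mem_core hk 0) (corner_mem_core hk (0 + 3 * k))
  rw [corner_add_three_mul hk, dist_eq_norm, sub_neg_eq_add, ← two_smul ℝ, norm_smul,
    norm_corner hk] at this
  simpa [ConvexPolygon.diameter] using this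

theorem core_isRegularCentred : (core hk).IsRegularCentred := by
  refine ⟨circumradius k, 0, circumradius_pos hk, fun j => ?_⟩
  have hk' : (1 : ℝ) ≤ k := by exact_mod_cast hk
  have e : 0 + 2 * Real.pi * (j : ℕ) / (core hk).n = stepAngle k * (((j : ℕ) : ℤ) : ℝ) := by
    simp only [core, stepAngle]
    push_cast
    field_simp
    ring
  rw [e]
  rfl

/-! ### The tiles and the lattice cells of a sector -/

/-- The hexagon with one diagonal on a boundary ray of a sector. -/
noncomputable def rayTile (j : ℤ) (m : ℕ) : ConvexPolygon :=
  hexagon ((m : ℝ) • corner k j) (corner k j) (corner k (j + 1)) (skew k)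
    (by rw [cross_corner_succ hk]; norm_num) (one_le_skew hk) (skew_lt_two hk)

/-- A hexagon contained in a sector. -/
noncomputable def innerTile (j : ℤ) (m n : ℕ) : ConvexPolygon :=
  hexagon ((m : ℝ) • corner k j + (n : ℝ) • corner k (j + 1)) (corner k j) (corner k (j + 1)) 1
    (by rw [cross_corner_succ hk]; norm_num) le_rfl (by norm_num)

/-- The tile whose centre has the coordinates `(m, n)` in the `j`-th sector. -/
noncomputable def tileAt (j : ℤ) (m n : ℕ) : ConvexPolygon :=
  if m = 0 ∧ n = 0 then core hk
  -- A tile on a ray has two names, one from each adjacent sector. The next two branches send both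
  -- to the same structure, since distinct members of the tiling must have disjoint interiors.
  else if n = 0 then rayTile hk j m
  else if m = 0 then rayTile hk (j + 1) n
  else innerTile hk j m n

/-- The tiling. -/
noncomputable def tiles : Set ConvexPolygon :=
  {p | ∃ (j : ℤ) (m n : ℕ), m ≡ n [MOD 3] ∧ p = tileAt hk j m n}

theorem tileAt_add_period (j : ℤ) (m n : ℕ) (z : ℤ) :
    tileAt hk (j + 6 * k * z) m n = tileAt hk j m n := by
  have h : ∀ i : ℤ, corner k (j + 6 * k * z + i) = corner k (j + i) := fun i => by
    rw [← corner_add_period hk (j + i) z]; congr 1; ring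
  have h0 := corner_add_period hk j z
  simp only [tileAt, rayTile, innerTile, add_assoc _ (1 : ℤ) 1, h, h0]

/-- The point with coordinates `(a, b)` lies in the model hexagon with centre `(m, n)`. -/
def InCell (a b : ℝ) (m n : ℕ) : Prop :=
  |a - m| ≤ 1 ∧ |b - n| ≤ 1 ∧ |a + b - (m + n)| ≤ 1

/-- The three vertices of a lattice triangle realise all three residues of `m - n` mod 3, so exactly
one is a centre, and the triangle lies in its cell. -/
theorem exists_cell {a b : ℝ} (ha : 0 ≤ a) (hb : 0 ≤ b) :
    ∃ m n : ℕ, m ≡ n [MOD 3] ∧ InCell a b m n := by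
  have a1 := Nat.floor_le ha
  have a2 := Nat.lt_floor_add_one a
  have b1 := Nat.floor_le hb
  have b2 := Nat.lt_floor_add_one b
  set i := ⌊a⌋₊
  set j := ⌊b⌋₊
  simp only [InCell, abs_le, Nat.ModEq]
  have h3 : i % 3 = j % 3 ∨ i % 3 = (j + 1) % 3 ∨ (i + 1) % 3 = j % 3 := by lia
  rcases h3 with h | h | h
  · rcases le_total (a + b) (i + j + 1) with hs | hs
    · exact ⟨i, j, h, by constructor <;> linarith, by constructor <;> linarith,
        by constructor <;> linarith⟩
    · refine ⟨i + 1, j + 1, by lia, ?_⟩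
      push_cast
      exact ⟨by constructor <;> linarith, by constructor <;> linarith,
        by constructor <;> linarith⟩
  · refine ⟨i, j + 1, h, ?_⟩
    push_cast
    exact ⟨by constructor <;> linarith, by constructor <;> linarith,
      by constructor <;> linarith⟩
  · refine ⟨i + 1, j, h, ?_⟩
    push_cast
    exact ⟨by constructor <;> linarith, by constructor <;> linarith,
      by constructor <;> linarith⟩

theorem natCast_le_add_one_of_abs_sub_le {x : ℝ} (hx : ∀ z : ℤ, x ≠ z) {p q : ℕ}
    (hp : |x - p| ≤ 1) (hq : |x - q| ≤ 1) : p ≤ q + 1 := by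
  by_contra! h
  have h' : (q : ℝ) + 2 ≤ p := by exact_mod_cast h
  rw [abs_le] at hp hq
  refine hx (q + 1 : ℕ) ?_
  push_cast
  linarith

/-- Off the lattice lines, two centres whose cells contain the point differ by at most 1 in `m`, in
`n` and in `m + n`. The only such difference compatible with the congruence mod 3 is zero. -/
theorem cell_unique {a b : ℝ} (ha : ∀ z : ℤ, a ≠ z) (hb : ∀ z : ℤ, b ≠ z)
    (hab : ∀ z : ℤ, a + b ≠ z) {m n m' n' : ℕ} (h : m ≡ n [MOD 3]) (h' : m' ≡ n' [MOD 3])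
    (hc : InCell a b m n) (hc' : InCell a b m' n') : m = m' ∧ n = n' := by
  obtain ⟨h1, h2, h3⟩ := hc
  obtain ⟨g1, g2, g3⟩ := hc'
  have a1 := natCast_le_add_one_of_abs_sub_le ha h1 g1
  have a2 := natCast_le_add_one_of_abs_sub_le ha g1 h1
  have b1 := natCast_le_add_one_of_abs_sub_le hb h2 g2
  have b2 := natCast_le_add_one_of_abs_sub_le hb g2 h2
  have c1 := natCast_le_add_one_of_abs_sub_le hab (p := m + n) (q := m' + n')
    (by push_cast; exact h3) (by push_cast; exact g3)
  have c2 := natCast_le_add_one_of_abs_sub_le hab (p := m' + n') (q := m + n)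
    (by push_cast; exact g3) (by push_cast; exact h3)
  simp only [Nat.ModEq] at h h'
  lia

end

/-! ### Tiles as unions of cells in sectors -/

section
variable {k : ℕ} (hk : 1 ≤ k)

theorem mem_rayTile_iff {j : ℤ} {m : ℕ} {x : Plane} : x ∈ (rayTile hk j m).carrier ↔
    ∃ p ∈ hexRegion (skew k), x = (p.1 + m) • corner k j + p.2 • corner k (j + 1) := by
  rw [rayTile, carrier_hexagon, Set.mem_image]
  refine exists_congr fun p => and_congr_right fun _ => ?_
  rw [eq_comm, frame_apply]
  have : p.1 • corner k j + p.2 • corner k (j + 1) + (m : ℝ) • corner k j =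
      (p.1 + m) • corner k j + p.2 • corner k (j + 1) := by module
  rw [this]

theorem mem_innerTile_iff {j : ℤ} {m n : ℕ} {x : Plane} : x ∈ (innerTile hk j m n).carrier ↔
    ∃ p ∈ hexRegion 1, x = (p.1 + m) • corner k j + (p.2 + n) • corner k (j + 1) := by
  rw [innerTile, carrier_hexagon, Set.mem_image]
  refine exists_congr fun p => and_congr_right fun _ => ?_
  rw [eq_comm, frame_apply]
  have : p.1 • corner k j + p.2 • corner k (j + 1) +
      ((m : ℝ) • corner k j + (n : ℝ) • corner k (j + 1)) =
      (p.1 + m) • corner k j + (p.2 + n) • corner k (j + 1) := by module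
  rw [this]

theorem mem_tileAt_of_inCell {j : ℤ} {m n : ℕ} {a b : ℝ} (ha : 0 ≤ a) (hb : 0 ≤ b)
    (h : InCell a b m n) : a • corner k j + b • corner k (j + 1) ∈ (tileAt hk j m n).carrier := by
  have hl := one_le_skew hk
  have hl' := skew_lt_two hk
  obtain ⟨h1, h2, h3⟩ := h
  rw [abs_le] at h1 h2 h3
  unfold tileAt
  split_ifs with c1 c2 c3
  · obtain ⟨rfl, rfl⟩ := c1
    simp only [Nat.cast_zero] at h3
    exact mem_core hk ha hb (by linarith)
  · subst c2
    simp only [Nat.cast_zero] at h2 h3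
    rw [mem_rayTile_iff]
    refine ⟨(a - m, b), ?_, by simp⟩
    simp only [hexRegion, Set.mem_ofPred_eq]
    refine ⟨?_, ?_, ?_, ?_, ?_, ?_⟩ <;> nlinarith
  · subst c3
    simp only [Nat.cast_zero] at h1 h3
    rw [mem_rayTile_iff]
    -- The point is rewritten in the frame of the next sector by eliminating `corner k j` with
    -- `corner_add_corner`; it falls in the lower half of the ray tile.
    refine ⟨(b - n + skew k * a, -a), ?_, ?_⟩
    · simp only [hexRegion, Set.mem_ofPred_eq]
      refine ⟨?_, ?_, ?_, ?_, ?_, ?_⟩ <;> nlinarith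
    · have e : corner k j = skew k • corner k (j + 1) - corner k (j + 1 + 1) := by
        rw [← corner_add_corner, add_assoc, one_add_one_eq_two]; abel
      simp only
      rw [e]
      module
  · rw [mem_innerTile_iff]
    refine ⟨(a - m, b - n), ?_, by simp⟩
    simp only [hexRegion, Set.mem_ofPred_eq]
    refine ⟨?_, ?_, ?_, ?_, ?_, ?_⟩ <;> linarith

/-- The sign of `t` tells on which side of the ray the point lies. Below it, the tile is renamed as
centre `(0, m)` of sector `j - 1`. Since `m ≥ 1`, the coordinate along the ray stays nonnegative. -/
theorem exists_inCell_of_mem_rayTile {j : ℤ} {m : ℕ} (hm0 : m ≠ 0) (hm : m ≡ 0 [MOD 3])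
    {x : Plane} (hx : x ∈ (rayTile hk j m).carrier) :
    ∃ (i : ℤ) (m' n' : ℕ) (a b : ℝ), m' ≡ n' [MOD 3] ∧ tileAt hk i m' n' = rayTile hk j m ∧
      0 ≤ a ∧ 0 ≤ b ∧ InCell a b m' n' ∧ x = a • corner k i + b • corner k (i + 1) := by
  have hl := one_le_skew hk
  have hl' := skew_lt_two hk
  have hm1 : (1 : ℝ) ≤ m := by exact_mod_cast Nat.one_le_iff_ne_zero.2 hm0
  rw [mem_rayTile_iff] at hx
  obtain ⟨⟨s, t⟩, hp, rfl⟩ := hx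
  simp only [hexRegion, Set.mem_ofPred_eq] at hp
  obtain ⟨p1, p2, p3, p4, p5, p6⟩ := hp
  rcases le_total 0 t with ht | ht
  · refine ⟨j, m, 0, s + m, t, hm, by simp [tileAt, hm0], by linarith, ht, ?_, rfl⟩
    simp only [InCell, abs_le, Nat.cast_zero]
    refine ⟨⟨?_, ?_⟩, ⟨?_, ?_⟩, ?_, ?_⟩ <;> linarith
  · refine ⟨j - 1, 0, m, -t, s + m + skew k * t, hm.symm, by simp [tileAt, hm0], by linarith,
      by linarith, ?_, ?_⟩
    · simp only [InCell, abs_le, Nat.cast_zero]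
      refine ⟨⟨?_, ?_⟩, ⟨?_, ?_⟩, ?_, ?_⟩ <;> nlinarith
    · have e := corner_add_corner k (j - 1)
      rw [sub_add_cancel, show j - 1 + 2 = j + 1 by ring] at e
      have e : corner k (j + 1) = skew k • corner k j - corner k (j - 1) := by
        rw [← e]; abel
      rw [e, sub_add_cancel]
      module

/-- A converse to `mem_tileAt_of_inCell`: sector and centre may have to be replaced by another name
of the same tile, chosen according to the point. -/
theorem exists_inCell_of_mem_tileAt {j : ℤ} {m n : ℕ} (h : m ≡ n [MOD 3]) {x : Plane}
    (hx : x ∈ (tileAt hk j m n).carrier) :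
    ∃ (i : ℤ) (m' n' : ℕ) (a b : ℝ), m' ≡ n' [MOD 3] ∧ tileAt hk i m' n' = tileAt hk j m n ∧
      0 ≤ a ∧ 0 ≤ b ∧ InCell a b m' n' ∧ x = a • corner k i + b • corner k (i + 1) := by
  by_cases c1 : m = 0 ∧ n = 0
  · obtain ⟨i, a, b, ha, hb, rfl⟩ := exists_sector hk x
    have hab : a + b ≤ 1 := by
      simp only [tileAt, if_pos c1] at hx
      exact add_le_one_of_mem_core hk hx
    refine ⟨i, 0, 0, a, b, rfl, by simp [tileAt, c1], ha, hb, ?_, rfl⟩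
    simp only [InCell, abs_le, Nat.cast_zero]
    refine ⟨⟨?_, ?_⟩, ⟨?_, ?_⟩, ?_, ?_⟩ <;> linarith
  by_cases c2 : n = 0
  · subst c2
    have e : tileAt hk j m 0 = rayTile hk j m := by simp_all [tileAt]
    rw [e] at hx ⊢
    exact exists_inCell_of_mem_rayTile hk (by tauto) h hx
  by_cases c3 : m = 0
  · subst c3
    have e : tileAt hk j 0 n = rayTile hk (j + 1) n := by simp_all [tileAt]
    rw [e] at hx ⊢
    exact exists_inCell_of_mem_rayTile hk c2 h.symm hx
  · have e : tileAt hk j m n = innerTile hk j m n := by simp_all [tileAt]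
    have hm1 : (1 : ℝ) ≤ m := by exact_mod_cast Nat.one_le_iff_ne_zero.2 c3
    have hn1 : (1 : ℝ) ≤ n := by exact_mod_cast Nat.one_le_iff_ne_zero.2 c2
    rw [e, mem_innerTile_iff] at hx
    obtain ⟨⟨s, t⟩, hp, rfl⟩ := hx
    simp only [hexRegion, Set.mem_ofPred_eq] at hp
    obtain ⟨p1, p2, p3, p4, p5, p6⟩ := hp
    refine ⟨j, m, n, s + m, t + n, h, rfl, by linarith, by linarith, ?_, rfl⟩
    simp only [InCell, abs_le]
    refine ⟨⟨?_, ?_⟩, ⟨?_, ?_⟩, ?_, ?_⟩ <;> linarith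

/-! ### Generic points and the tiling property -/

/-- A line in the plane is a null set. -/
theorem volume_setOf_cross_eq {y : Plane} (hy : y ≠ 0) (c : ℝ) :
    volume {x | cross y x = c} = 0 := by
  let s : AffineSubspace ℝ Plane :=
    { carrier := {x | cross y x = c}
      smul_vsub_vadd_mem' := by
        intro r p q w hp hq hw
        simp only [Set.mem_ofPred_eq, cross, vsub_eq_sub, vadd_eq_add, PiLp.add_apply,
          PiLp.smul_apply, PiLp.sub_apply, smul_eq_mul] at *
        linear_combination r * hp - r * hq + hw }
  refine Measure.addHaar_affineSubspace volume s fun hs => hy ?_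
  have h0 : cross y 0 = c := by
    change (0 : Plane) ∈ s
    rw [hs]; trivial
  have h1 : cross y !₂[-y 1, y 0] = c := by
    change (!₂[-y 1, y 0] : Plane) ∈ s
    rw [hs]; trivial
  simp [cross] at h0 h1
  have e0 : y 0 = 0 := by nlinarith
  have e1 : y 1 = 0 := by nlinarith
  ext i
  fin_cases i
  · exact e0
  · exact e1

/-- Almost no point lies on a line that carries edges or diagonals of tiles. -/
theorem ae_generic {k : ℕ} (hk : 1 ≤ k) : ∀ᵐ x : Plane, ∀ (j : ℤ) (a b : ℝ),
    x = a • corner k j + b • corner k (j + 1) →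
      (∀ z : ℤ, a ≠ z) ∧ (∀ z : ℤ, b ≠ z) ∧ ∀ z : ℤ, a + b ≠ z := by
  -- Crossing with corners reads off `a`, `b` and `a + b` up to the factor `1/3` and sign, so an
  -- integer value puts `x` on one of countably many lines.
  have key : ∀ᵐ x : Plane, ∀ j z : ℤ, cross (corner k (j + 1)) x ≠ -(z / 3) ∧
      cross (corner k j) x ≠ z / 3 ∧ cross (corner k j - corner k (j + 1)) x ≠ z / 3 := by
    have hne : ∀ j, corner k j ≠ 0 := fun j h => by
      have := norm_corner hk j
      rw [h, norm_zero] at this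
      exact (circumradius_pos hk).ne this
    have hne' : ∀ j, corner k j - corner k (j + 1) ≠ 0 := fun j h => by
      have := cross_corner_succ hk j
      rw [sub_eq_zero.1 h] at this
      simp [cross, mul_comm] at this
    have hae : ∀ {y : Plane}, y ≠ 0 → ∀ c : ℝ, ∀ᵐ x : Plane, cross y x ≠ c := fun hy c => by
      rw [ae_iff]
      simpa using volume_setOf_cross_eq hy c
    rw [ae_all_iff]
    intro j
    rw [ae_all_iff]
    intro z
    exact (hae (hne _) _).and ((hae (hne _) _).and (hae (hne' _) _))
  filter_upwards [key] with x hx j a b hxab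
  have c := cross_corner_succ hk j
  have e1 : cross (corner k (j + 1)) x = -(a / 3) := by
    have : cross (corner k (j + 1)) x = - (a * cross (corner k j) (corner k (j + 1))) := by
      rw [hxab]; simp [cross]; ring
    rw [this, c]; ring
  have e2 : cross (corner k j) x = b / 3 := by
    have : cross (corner k j) x = b * cross (corner k j) (corner k (j + 1)) := by
      rw [hxab]; simp [cross]; ring
    rw [this, c]; ring
  have e3 : cross (corner k j - corner k (j + 1)) x = (a + b) / 3 := by
    have : cross (corner k j - corner k (j + 1)) x =
        cross (corner k j) x - cross (corner k (j + 1)) x := by simp [cross]; ring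
    rw [this, e1, e2]; ring
  refine ⟨fun z h => (hx j z).1 ?_, fun z h => (hx j z).2.1 ?_, fun z h => (hx j z).2.2 ?_⟩
  · rw [e1, h]
  · rw [e2, h]
  · rw [e3, h]

theorem tiles_isTiling : IsTiling (tiles hk) := by
  refine ⟨Set.eq_univ_of_forall fun x => ?_, ?_⟩
  · obtain ⟨j, a, b, ha, hb, rfl⟩ := exists_sector hk x
    obtain ⟨m, n, hmn, hc⟩ := exists_cell ha hb
    exact Set.mem_biUnion (x := tileAt hk j m n) ⟨j, m, n, hmn, rfl⟩
      (mem_tileAt_of_inCell hk ha hb hc)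
  · rintro p ⟨j, m, n, hmn, rfl⟩ q ⟨j', m', n', hmn', rfl⟩ hpq
    rw [Set.disjoint_iff_inter_eq_empty]
    by_contra hne
    refine hpq ?_
    -- A nonempty overlap of interiors is open, so it has positive measure and contains a generic
    -- point. Its sector, up to full turns, and its cell are unique, which identifies the two tiles.
    have hpos := (isOpen_interior.inter isOpen_interior).measure_pos volume
      (Set.nonempty_iff_ne_empty.2 hne)
    obtain ⟨x, ⟨hx, hx'⟩, hgen⟩ : ∃ x ∈ interior (tileAt hk j m n).carrier ∩
        interior (tileAt hk j' m' n').carrier, ∀ (j : ℤ) (a b : ℝ),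
        x = a • corner k j + b • corner k (j + 1) →
          (∀ z : ℤ, a ≠ z) ∧ (∀ z : ℤ, b ≠ z) ∧ ∀ z : ℤ, a + b ≠ z := by
      by_contra! h
      refine hpos.ne' (measure_mono_null ?_ (ae_iff.1 (ae_generic hk)))
      intro x hx hall
      obtain ⟨j, a, b, e, hc⟩ := h x hx
      obtain ⟨g1, g2, g3⟩ := hall j a b e
      obtain ⟨z, hz⟩ := hc g1 g2
      exact g3 z hz
    obtain ⟨i, u, v, a, b, huv, ht, ha, hb, hc, e⟩ :=
      exists_inCell_of_mem_tileAt hk hmn (interior_subset hx)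
    obtain ⟨i', u', v', a', b', huv', ht', ha', hb', hc', e'⟩ :=
      exists_inCell_of_mem_tileAt hk hmn' (interior_subset hx')
    obtain ⟨g1, g2, g3⟩ := hgen i a b e
    have ha0 : 0 < a := lt_of_le_of_ne ha (by simpa using (g1 0).symm)
    have hb0 : 0 < b := lt_of_le_of_ne hb (by simpa using (g2 0).symm)
    obtain ⟨⟨z, rfl⟩, rfl, rfl⟩ := sector_unique hk ha0 hb0 ha' hb' (e.symm.trans e')
    obtain ⟨rfl, rfl⟩ := cell_unique g1 g2 g3 huv huv' hc hc'
    rw [← ht, ← ht', tileAt_add_period]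

/-! ### Normality, extremal diameter and area, total index -/

theorem hexagonTile_properties {k : ℕ} (hk : 1 ≤ k) {o u w : Plane} {l : ℝ} (huw : 0 < cross u w) (h1 : 1 ≤ l)
    (h2 : l < 2) (hc : cross u w = 1 / 3) (hu : ‖u‖ ≤ circumradius k) (hw : ‖w‖ ≤ circumradius k)
    (hwu : ‖w - u‖ ≤ circumradius k) (hz : ‖l • u - w‖ ≤ circumradius k)
    (hzu : ‖(l - 1) • u - w‖ ≤ circumradius k) {p : ConvexPolygon}
    (hp : p = hexagon o u w l huw h1 h2) :
    p.numEdges = 6 ∧ p.area = 1 ∧ ∃ o, Metric.closedBall o (1 / (9 * circumradius k)) ⊆ p.carrier ∧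
      p.carrier ⊆ Metric.closedBall o (circumradius k) := by
  subst hp
  refine ⟨?_, ?_, o, ?_, ?_⟩
  · rw [ConvexPolygon.numEdges_eq]; rfl
  · rw [area_hexagon, hc]; norm_num
  · exact closedBall_subset_carrier_hexagon _ _ _ (circumradius_pos hk) hu hw hc.ge
  · exact carrier_hexagon_subset_closedBall _ _ _ hu hw hwu hz hzu

/-- With `l = skew k`, the vector `l • u - w` is the preceding corner. So the vertices seen from the
centre are corners up to sign, or differences of adjacent corners, all of norm at most the
circumradius. -/
theorem rayTile_properties (j : ℤ) (m : ℕ) :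
    (rayTile hk j m).numEdges = 6 ∧ (rayTile hk j m).area = 1 ∧
      ∃ o, Metric.closedBall o (1 / (9 * circumradius k)) ⊆ (rayTile hk j m).carrier ∧
      (rayTile hk j m).carrier ⊆ Metric.closedBall o (circumradius k) := by
  have e := corner_add_corner k (j - 1)
  rw [sub_add_cancel, show j - 1 + 2 = j + 1 by ring] at e
  have e1 : skew k • corner k j - corner k (j + 1) = corner k (j - 1) := by
    rw [← e]; abel
  have e2 : (skew k - 1) • corner k j - corner k (j + 1) = corner k (j - 1) - corner k j := by
    rw [← e1]; module
  refine hexagonTile_properties hk _ _ _ (cross_corner_succ hk j) (norm_corner hk _).le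
    (norm_corner hk _).le (norm_corner_succ_sub hk j) ?_ ?_ rfl
  · rw [e1]; exact (norm_corner hk _).le
  · rw [e2, norm_sub_rev]
    simpa using norm_corner_succ_sub hk (j - 1)

theorem innerTile_properties (j : ℤ) (m n : ℕ) :
    (innerTile hk j m n).numEdges = 6 ∧ (innerTile hk j m n).area = 1 ∧
      ∃ o, Metric.closedBall o (1 / (9 * circumradius k)) ⊆ (innerTile hk j m n).carrier ∧
      (innerTile hk j m n).carrier ⊆ Metric.closedBall o (circumradius k) := by
  refine hexagonTile_properties hk _ _ _ (cross_corner_succ hk j) (norm_corner hk _).le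
    (norm_corner hk _).le (norm_corner_succ_sub hk j) ?_ ?_ rfl
  · rw [one_smul, norm_sub_rev]; exact norm_corner_succ_sub hk j
  · simpa using (norm_corner hk _).le

theorem eq_core_or_of_mem_tiles {p : ConvexPolygon} (hp : p ∈ tiles hk) : p = core hk ∨
    (p.numEdges = 6 ∧ p.area = 1 ∧ ∃ o, Metric.closedBall o (1 / (9 * circumradius k)) ⊆ p.carrier ∧
      p.carrier ⊆ Metric.closedBall o (circumradius k)) := by
  obtain ⟨j, m, n, -, rfl⟩ := hp
  unfold tileAt
  split_ifs
  · exact Or.inl rfl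
  · exact Or.inr (rayTile_properties hk _ _)
  · exact Or.inr (rayTile_properties hk _ _)
  · exact Or.inr (innerTile_properties hk _ _ _)

theorem core_mem_tiles : core hk ∈ tiles hk := ⟨0, 0, 0, rfl, by simp [tileAt]⟩

theorem tiles_isNormal : IsNormal (tiles hk) := by
  have hρ := circumradius_pos hk
  refine ⟨1 / (9 * circumradius k), circumradius k, by positivity, hρ, fun p hp => ?_⟩
  rcases eq_core_or_of_mem_tiles hk hp with rfl | ⟨-, -, o, h1, h2⟩
  · exact ⟨⟨0, closedBall_subset_core hk⟩, ⟨0, core_subset_closedBall hk⟩⟩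
  · exact ⟨⟨o, h1⟩, ⟨o, h2⟩⟩

theorem numEdges_core : (core hk).numEdges = 6 * k := by
  rw [ConvexPolygon.numEdges_eq]; rfl

theorem isGreatest_diameter_tiles :
    IsGreatest (ConvexPolygon.diameter '' tiles hk) (2 * circumradius k) := by
  refine ⟨⟨core hk, core_mem_tiles hk, diameter_core hk⟩, ?_⟩
  rintro _ ⟨p, hp, rfl⟩
  rcases eq_core_or_of_mem_tiles hk hp with rfl | ⟨-, -, o, -, h⟩
  · exact (diameter_core hk).le
  · exact diameter_le_of_subset_closedBall p (circumradius_pos hk).le h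

theorem isLeast_area_tiles : IsLeast (ConvexPolygon.area '' tiles hk) 1 := by
  refine ⟨⟨innerTile hk 0 1 1, ⟨0, 1, 1, rfl, by simp [tileAt]⟩,
    (innerTile_properties hk 0 1 1).2.1⟩, ?_⟩
  rintro _ ⟨p, hp, rfl⟩
  rcases eq_core_or_of_mem_tiles hk hp with rfl | ⟨-, h, -⟩
  · exact one_le_area_core hk
  · exact h.ge

theorem index_eq_zero_of_mem_tiles {p : ConvexPolygon} (hp : p ∈ tiles hk) (h : p ≠ core hk) :
    p.index = 0 := by
  have := ((eq_core_or_of_mem_tiles hk hp).resolve_left h).1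
  simp [ConvexPolygon.index, this]

theorem totalIndex_tiles : totalIndex (tiles hk) = 6 * (k : ℤ) - 6 := by
  have h : ∑ᶠ p ∈ tiles hk, p.index = ∑ᶠ p ∈ ({core hk} : Set ConvexPolygon), p.index := by
    refine finsum_mem_inter_support_eq _ _ _ (Set.ext fun p => ?_)
    simp only [Set.mem_inter_iff, Function.mem_support, Set.mem_singleton_iff]
    refine and_congr_left fun hp => ⟨fun hm => ?_, fun hm => hm ▸ core_mem_tiles hk⟩
    by_contra hne
    exact hp (index_eq_zero_of_mem_tiles hk hm hne)
  rw [totalIndex, h, finsum_mem_singleton, ConvexPolygon.index, numEdges_core]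
  push_cast
  rfl

end

/-! ### The limit and the conclusion -/

/-- Since `π` is `3k` steps, `2πD²` equals `8k / sinc β`. Dividing numerator and denominator by `k`
leaves terms with obvious limits. -/
theorem tendsto_index_ratio :
    Tendsto (fun k : ℕ => (2 * Real.pi * (2 * circumradius k) ^ 2 / 1 - 6) /
      ((6 * (k : ℤ) - 6 : ℤ) : ℝ)) atTop (𝓝 (4 / 3)) := by
  have hβ : Tendsto stepAngle atTop (𝓝 0) :=
    tendsto_const_nhds.div_atTop (tendsto_natCast_atTop_atTop.const_mul_atTop (by norm_num))
  have hs : Tendsto (fun k => Real.sinc (stepAngle k)) atTop (𝓝 1) := by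
    rw [← Real.sinc_zero]
    exact (Real.continuous_sinc.tendsto 0).comp hβ
  have hi : Tendsto (fun k : ℕ => (6 : ℝ) / k) atTop (𝓝 0) :=
    tendsto_const_nhds.div_atTop tendsto_natCast_atTop_atTop
  have hlim : Tendsto (fun k : ℕ => (8 / Real.sinc (stepAngle k) - 6 / k) / (6 - 6 / (k : ℝ)))
      atTop (𝓝 ((8 / 1 - 0) / (6 - 0))) :=
    ((tendsto_const_nhds.div hs one_ne_zero).sub hi).div (tendsto_const_nhds.sub hi) (by norm_num)
  have e : ((8 / 1 - 0) / (6 - 0) : ℝ) = 4 / 3 := by norm_num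
  rw [e] at hlim
  refine hlim.congr' ?_
  -- For `k = 1` the total index vanishes, so the rewriting of the quotient starts at 2.
  filter_upwards [eventually_ge_atTop 2] with k hk2
  have hk : 1 ≤ k := by lia
  have hk' : (2 : ℝ) ≤ k := by exact_mod_cast hk2
  have hpos := sin_stepAngle_pos hk
  have hβ0 := stepAngle_pos hk
  have hπ := Real.pi_pos
  have h6 : (6 * k - 6 : ℝ) ≠ 0 := by linarith
  rw [Real.sinc_of_ne_zero hβ0.ne', mul_pow, circumradius_sq hk, ← mul_stepAngle hk]
  have e1 : (6 - 6 / (k : ℝ)) = (6 * k - 6) / k := by field_simp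
  rw [e1]
  push_cast
  field_simp
  ring

theorem theorem5 :
    ∃ (F : ℕ → Set ConvexPolygon) (D A : ℕ → ℝ),
      (∀ k : ℕ, 1 ≤ k →
        IsTiling (F k) ∧ IsNormal (F k) ∧
        (∀ p ∈ F k, 6 ≤ p.numEdges) ∧
        (∃ c ∈ F k, c.numEdges = 6 * k ∧ c.IsRegularCentred ∧
          ∀ p ∈ F k, p ≠ c → p.numEdges = 6 ∧ p.area = 1) ∧
        IsGreatest (ConvexPolygon.diameter '' F k) (D k) ∧
        IsLeast (ConvexPolygon.area '' F k) (A k) ∧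
        {p ∈ F k | p.index ≠ 0}.Finite ∧
        totalIndex (F k) = 6 * (k : ℤ) - 6) ∧
      Tendsto (fun k : ℕ => (2 * Real.pi * D k ^ 2 / A k - 6) / (totalIndex (F k) : ℝ))
        atTop (𝓝 (4 / 3)) := by
  classical
  -- The value at `k = 0` is arbitrary, as the core exists only for `k ≥ 1`.
  let F : ℕ → Set ConvexPolygon := fun k => if hk : 1 ≤ k then tiles hk else ∅
  have hF : ∀ {k : ℕ} (hk : 1 ≤ k), F k = tiles hk := fun hk => dif_pos hk
  refine ⟨F, fun k => 2 * circumradius k, fun _ => 1, fun k hk => ?_, ?_⟩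
  · rw [hF hk]
    refine ⟨tiles_isTiling hk, tiles_isNormal hk, fun p hp => ?_,
      ⟨core hk, core_mem_tiles hk, numEdges_core hk, core_isRegularCentred hk,
        fun p hp hne => ?_⟩,
      isGreatest_diameter_tiles hk, isLeast_area_tiles hk, ?_, totalIndex_tiles hk⟩
    · rcases eq_core_or_of_mem_tiles hk hp with rfl | ⟨h, -⟩
      · rw [numEdges_core]; lia
      · exact h.ge
    · have h := (eq_core_or_of_mem_tiles hk hp).resolve_left hne
      exact ⟨h.1, h.2.1⟩
    · refine (Set.finite_singleton (core hk)).subset fun p hp => ?_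
      by_contra hne
      exact hp.2 (index_eq_zero_of_mem_tiles hk hp.1 hne)
  · refine tendsto_index_ratio.congr' ?_
    filter_upwards [eventually_ge_atTop 1] with k hk
    rw [hF hk, totalIndex_tiles hk]
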